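/- **The game.** Fix $\mu\in(0,1)$ and $k>0$. Two senders $i\in\{1,2\}$ have independent types $\omega_i\in\{0,1\}$ with $\Pr(\omega_i=1)=\mu$. Each sender simultaneously commits to a Borel probability distribution $p_i$ of posterior beliefs on $[0,1]$ with $\int x\,dp_i(x)=\mu$. The receiver does not observe $p_1,p_2$. She either selects a sender without any visit (possibly at random) or visits a sender first (the order may be randomized). At the sender $i$ visited first she observes $p_i$ and chooses a garbling $q_i$ of it (a distribution on $[0,1]$ with the same mean that second-order stochastically dominates $p_i$), pays the attention cost $\int k(x-\mu)^2\,dq_i(x)$, and draws a posterior from $q_i$. She then decides whether to visit the other sender $j$; if she does, she observes $p_j$, chooses a garbling $q_j$ of it, pays $\int k(x-\mu)^2\,dq_j(x)$, and draws a posterior from $q_j$. Finally she selects one of the two senders, visited or not. Her payoff is the expected type of the selected sender minus the attention costs; a sender's payoff is the probability that he is selected. Apart from the randomizations mentioned, strategies are pure. In an equilibrium, no sender gains by deviating to another distribution (a deviation is seen by the receiver only when she visits the deviator), and the receiver's strategy is optimal at each of her information sets, including those after deviations, when she expects a not yet visited sender to offer his equilibrium distribution. **Corollary.** 1. Let $\mu\le\frac12$.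 If $k\ge\frac1{2\mu}$, then there is an equilibrium in which both senders offer the uniform distribution on $[0,2\mu]$. 2. Let $\mu>\frac12$. If either $\mu\le\frac23$ and $k\ge\frac1{2\mu}$, or $\mu\ge\frac23$ and $k\ge\frac1{4(1-\mu)}$, then there is an equilibrium in which both senders offer the distribution on $[0,1]$ whose CDF has continuous portion $F(x)=\frac{x}{2\mu}$ on $[0,2(1-\mu)]$ and which has a point mass of size $2-\frac1\mu$ at $1$ (so that $F$ is constant on $[2(1-\mu),1)$). -/

import Mathlib

open MeasureTheory
open scoped unitInterval

noncomputable section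

namespace AttentionGame

/-- The two senders. The rival of sender `i` is `!i`. -/
abbrev Sender := Bool

/-- A sender's choice: a Borel probability distribution of posterior beliefs on `[0,1]` whose
average is the prior `μ`. -/
@[ext] structure Experiment (μ : ℝ) where
  dist : Measure I
  isProb : IsProbabilityMeasure dist
  mean_eq : ∫ x, (x : ℝ) ∂dist = μ

attribute [instance] Experiment.isProb

variable {μ : ℝ}

/-- `q` is a garbling (mean preserving contraction) of `p`: `q` second order stochastically
dominates `p`, that is, every nondecreasing concave utility function prefers `q` to `p`. The means
agree because both are elements of `Experiment μ`. -/
def IsGarbling (q p : Experiment μ) : Prop :=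
  ∀ u : ℝ → ℝ, ConcaveOn ℝ Set.univ u → Monotone u →
    ∫ x, u (x : ℝ) ∂p.dist ≤ ∫ x, u (x : ℝ) ∂q.dist

/-- The receiver's first move. `stay a`: she visits nobody, and selects sender `false` with
probability `a` and sender `true` with probability `1 - a`. `visit a`: she visits sender `false`
first with probability `a`, and sender `true` first with probability `1 - a`. -/
inductive FirstMove where
  | stay (a : I)
  | visit (a : I)

/-- The receiver's behaviour after the draw `x` from the garbling chosen for the sender visited
first. All choices are pure and measurable in the beliefs drawn. -/
structure Continuation (μ : ℝ) where
  /-- whether to visit the other sender -/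
  goOn : I → Bool
  /-- without a second visit: whether to select the visited sender (`true`) or the other one -/
  keep : I → Bool
  /-- with a second visit: the garbling of the distribution `d` found there -/
  garble : Experiment μ → I → Experiment μ
  /-- with a second visit, having found `d` there and drawn `y`: whether to select the sender
  visited first (`true`) or the one visited second (`false`) -/
  keepBoth : Experiment μ → I → I → Bool
  garble_isGarbling : ∀ d x, IsGarbling (garble d x) d
  measurable_goOn : Measurable goOn
  measurable_keep : Measurable keep
  measurable_garble : ∀ d, Measurable fun x => (garble d x).dist
  measurable_keepBoth : ∀ d, Measurable fun z : I × I => keepBoth d z.1 z.2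

/-- A strategy of the receiver: whom to visit first, if anyone; the garbling of any distribution
found at the sender visited first; and the continuation after the belief drawn there. -/
structure Strategy (μ : ℝ) where
  first : FirstMove
  garble : Sender → Experiment μ → Experiment μ
  garble_isGarbling : ∀ i d, IsGarbling (garble i d) d
  cont : Sender → Continuation μ

/-- The attention cost of a posterior `y`. -/
def beliefCost (k μ : ℝ) (y : I) : ℝ := k * ((y : ℝ) - μ) ^ 2

/-- The belief about the selected sender when no second visit is made. -/
def Continuation.finalOne (c : Continuation μ) (x : I) : ℝ :=
  if c.keep x then (x : ℝ) else μ

/-- The belief about the selected sender when both were visited, with draws `x` and then `y`. -/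
def Continuation.finalBoth (c : Continuation μ) (d : Experiment μ) (x y : I) : ℝ :=
  if c.keepBoth d x y then (x : ℝ) else (y : ℝ)

/-- The receiver's expected payoff at stage 2, having drawn `x`, visited the second sender and
found `d` there. Attention costs paid at stage 1 are sunk and not included. -/
def Continuation.valueBoth (k : ℝ) (c : Continuation μ) (d : Experiment μ) (x : I) : ℝ :=
  ∫ y, (c.finalBoth d x y - beliefCost k μ y) ∂(c.garble d x).dist

/-- The receiver's expected payoff after the draw `x`, before she decides on a second visit, if
the second sender offers `d`. -/
def Continuation.value (k : ℝ) (c : Continuation μ) (d : Experiment μ) (x : I) : ℝ :=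
  if c.goOn x then c.valueBoth k d x else c.finalOne x

/-- The probability that the sender visited first is selected, given the draw `x`, if the second
sender offers `d`. -/
def Continuation.keepProb (c : Continuation μ) (d : Experiment μ) (x : I) : ℝ :=
  if c.goOn x then (c.garble d x).dist.real {y | c.keepBoth d x y = true}
  else if c.keep x then 1 else 0

/-- The receiver's expected payoff upon visiting sender `i` first and finding `d` there, if the
other sender offers `e`. -/
def Strategy.valueAt (k : ℝ) (s : Strategy μ) (i : Sender) (d e : Experiment μ) : ℝ :=
  ∫ x, ((s.cont i).value k e x - beliefCost k μ x) ∂(s.garble i d).dist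

/-- The receiver's ex ante expected payoff when sender `i` offers `p i`. -/
def Strategy.value (k : ℝ) (s : Strategy μ) (p : Sender → Experiment μ) : ℝ :=
  match s.first with
  | .stay _ => μ
  | .visit a => (a : ℝ) * s.valueAt k false (p false) (p true)
      + (1 - (a : ℝ)) * s.valueAt k true (p true) (p false)

/-- The probability that sender `i`, visited first and offering `d`, is selected, if the other
sender offers `e`. -/
def Strategy.winFirst (s : Strategy μ) (i : Sender) (d e : Experiment μ) : ℝ :=
  ∫ x, (s.cont i).keepProb e x ∂(s.garble i d).dist

/-- For `a` the probability of sender `false`, the probability of sender `i`. -/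
def probOf (a : I) (i : Sender) : ℝ := if i then 1 - (a : ℝ) else (a : ℝ)

/-- Sender `i`'s expected payoff: the probability that he is selected. -/
def Strategy.senderPayoff (s : Strategy μ) (p : Sender → Experiment μ) (i : Sender) : ℝ :=
  match s.first with
  | .stay a => probOf a i
  | .visit a => probOf a i * s.winFirst i (p i) (p (!i))
      + probOf a (!i) * (1 - s.winFirst (!i) (p (!i)) (p i))

/-- The strategy `s` is optimal for the receiver at each of her information sets, among all of her
strategies, when she expects each not yet visited sender `j` to offer `p j`. -/
structure SequentiallyRational (k : ℝ) (p : Sender → Experiment μ) (s : Strategy μ) : Prop where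
  /-- before any visit -/
  initial : ∀ t : Strategy μ, t.value k p ≤ s.value k p
  /-- visiting sender `i` first, having found any distribution `d` there -/
  stageOne : ∀ (i : Sender) (d : Experiment μ) (t : Strategy μ),
    t.valueAt k i d (p (!i)) ≤ s.valueAt k i d (p (!i))
  /-- after any belief `x` drawn for the sender `i` visited first -/
  afterDraw : ∀ (i : Sender) (x : I) (c : Continuation μ),
    c.value k (p (!i)) x ≤ (s.cont i).value k (p (!i)) x
  /-- visiting the other sender after that, having found any distribution `d` there -/
  stageTwo : ∀ (i : Sender) (x : I) (d : Experiment μ) (c : Continuation μ),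
    c.valueBoth k d x ≤ (s.cont i).valueBoth k d x
  /-- the final selection without a second visit -/
  selectOne : ∀ (i : Sender) (x : I) (c : Continuation μ),
    c.finalOne x ≤ (s.cont i).finalOne x
  /-- the final selection after two visits -/
  selectBoth : ∀ (i : Sender) (x y : I) (d : Experiment μ) (c : Continuation μ),
    c.finalBoth d x y ≤ (s.cont i).finalBoth d x y

/-- Equilibrium: the receiver is sequentially rational, and no sender gains by deviating to another
distribution. A deviation is seen by the receiver only when she visits the deviating sender. -/
def IsEquilibrium (k : ℝ) (p : Sender → Experiment μ) (s : Strategy μ) : Prop :=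
  SequentiallyRational k p s ∧
    ∀ (i : Sender) (d : Experiment μ),
      s.senderPayoff (Function.update p i d) i ≤ s.senderPayoff p i

/-- There is an equilibrium in which both senders offer the distribution `ν` of posteriors. -/
def BothOfferInEquilibrium (μ k : ℝ) (ν : Measure I) : Prop :=
  ∃ (p : Sender → Experiment μ) (s : Strategy μ),
    IsEquilibrium k p s ∧ ∀ i, (p i).dist = ν

/-- The uniform distribution on `[0, b]`, for `0 < b ≤ 1`. -/
def uniformTo (b : ℝ) : Measure I :=
  ProbabilityTheory.cond volume {x : I | (x : ℝ) ≤ b}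

/-- The distribution with continuous part `F(x) = x / (2μ)` on `[0, 2(1-μ)]` and an atom of size
`2 - 1/μ` at `1`. -/
def uniformWithAtom (μ : ℝ) : Measure I :=
  ENNReal.ofReal (1 / (2 * μ)) • volume.restrict {x : I | (x : ℝ) ≤ 2 * (1 - μ)}
    + ENNReal.ofReal (2 - 1 / μ) • Measure.dirac 1

end AttentionGame

end

noncomputable section

namespace AttentionGame

/-! Put δ = 1/(4k). Once x has been drawn at the first visit, a draw y at the second is worth max(x,
y) - k(y-μ)². This is the maximum of two parabolas, with a common tangent touching them at x-δ and
x+δ. Evaluating the tangent at μ bounds the continuation payoff by μ + k(x-μ+δ)², and stopping obeys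
the same bound. Subtracting the first cost k(x-μ)² leaves (x+μ)/2 + δ/4, which is affine in x, so no
first garbling of any distribution can yield more than μ + δ/4.

Two plans attain this bound. One splits the first sender into μ±δ and stops, keeping him exactly at
μ+δ. The other learns nothing from him and splits the second sender into μ±δ. The receiver uses the
first plan when she finds the equilibrium distribution ν and the second when she finds anything
else. Either way the sender visited first wins with probability 1/2. A deviation at the sender not
visited first is never seen, so no sender can gain (`exists_equilibrium`).

It remains that the even split into μ±δ is a garbling of ν. Comparing expected excesses over every
threshold, this says that the best half of the mass of ν has mean at least μ+δ, which gives the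
conditions on k (`bothOfferInEquilibrium_blockWithAtom`).

Sequential rationality also requires, for every distribution found at the second visit, an optimal
garbling that is measurable in x. Two-point garblings suffice there (`exists_feasible_ge`). They are
parametrized by a compact set of pairs, on which a measurable maximizer can be selected. -/

/-! ### Measurable selection of maximizers -/

/-- Since `I` is compact, each fibre attains its infimum and projections of closed sets along `I`
are closed. Hence the sublevel sets are closed. The level `⊤` is separate because an empty fibre has
infimum `⊤`. -/
theorem measurable_sInf_fiber {Z : Type*} [TopologicalSpace Z] [MeasurableSpace Z]
    [OpensMeasurableSpace Z] {C : Set (Z × I)} (hC : IsClosed C) :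
    Measurable fun z => sInf {b : I | (z, b) ∈ C} := by
  refine measurable_of_Iic fun β => ?_
  rcases eq_or_ne β ⊤ with rfl | hβ
  · simp
  have hfib : ∀ z, IsClosed {b : I | (z, b) ∈ C} := fun z => hC.preimage (by fun_prop)
  have : (fun z => sInf {b : I | (z, b) ∈ C}) ⁻¹' Set.Iic β
      = Prod.fst '' (C ∩ Prod.snd ⁻¹' Set.Iic β) := by
    ext z
    simp only [Set.mem_preimage, Set.mem_Iic, Set.mem_image, Set.mem_inter_iff]
    constructor
    · intro h
      rcases Set.eq_empty_or_nonempty {b : I | (z, b) ∈ C} with he | hne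
      · rw [he, sInf_empty] at h
        exact absurd (top_le_iff.1 h) hβ
      · exact ⟨(z, _), ⟨(hfib z).sInf_mem hne, h⟩, rfl⟩
    · rintro ⟨⟨z', b⟩, ⟨h1, h2⟩, rfl⟩
      exact (sInf_le (show b ∈ {b : I | (z', b) ∈ C} from h1)).trans h2
  rw [this]
  exact (isClosedMap_fst_of_compactSpace _
    (hC.inter (isClosed_Iic.preimage continuous_snd))).measurableSet

/-- A measurable maximizer, chosen lexicographically. -/
theorem exists_measurable_argmax {K : Set (I × I)} (hK : IsClosed K) (hne : K.Nonempty)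
    {J : I × (I × I) → ℝ} (hJ : ContinuousOn J (Set.univ ×ˢ K)) :
    ∃ sel : I → I × I, Measurable sel ∧
      ∀ x, sel x ∈ K ∧ ∀ z ∈ K, J (x, z) ≤ J (x, sel x) := by
  -- The graph of the argmax correspondence. It is closed because it is cut out by weak inequalities
  -- between functions continuous on a closed set.
  set G : Set (I × (I × I)) :=
    {p | p ∈ Set.univ ×ˢ K ∧ ∀ z ∈ K, J (p.1, z) ≤ J p} with hG
  have hGc : IsClosed G := by
    have hU : IsClosed ((Set.univ : Set I) ×ˢ K) := isClosed_univ.prod hK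
    have : G = (Set.univ ×ˢ K) ∩ ⋂ z ∈ K, {p | p ∈ Set.univ ×ˢ K ∧ J (p.1, z) ≤ J p} := by
      ext p
      simp only [hG, Set.mem_ofPred_eq, Set.mem_inter_iff, Set.mem_iInter]
      exact ⟨fun h => ⟨h.1, fun z hz => ⟨h.1, h.2 z hz⟩⟩, fun h => ⟨h.1, fun z hz => (h.2 z hz).2⟩⟩
    rw [this]
    refine hU.inter (isClosed_biInter fun z hz => ?_)
    refine hU.isClosed_le (hJ.comp (by fun_prop) ?_) hJ
    exact fun p _ => ⟨trivial, hz⟩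
  have hGne : ∀ x, ∃ z, (x, z) ∈ G := by
    intro x
    obtain ⟨z, hz, hmax⟩ := hK.isCompact.exists_isMaxOn hne
      (f := fun z => J (x, z)) (hJ.comp (by fun_prop) fun z hz => ⟨trivial, hz⟩)
    exact ⟨z, ⟨trivial, hz⟩, fun w hw => hmax hw⟩
  set G₂ : Set ((I × I) × I) := {q | (q.1.1, (q.1.2, q.2)) ∈ G} with hG₂
  have hG₂c : IsClosed G₂ := hGc.preimage (by fun_prop)
  set G₁ : Set (I × I) := Prod.fst '' G₂ with hG₁
  have hG₁c : IsClosed G₁ := isClosedMap_fst_of_compactSpace _ hG₂c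
  set a : I → I := fun x => sInf {b | (x, b) ∈ G₁}
  set b : I × I → I := fun p => sInf {b | (p, b) ∈ G₂}
  have ha : Measurable a := measurable_sInf_fiber hG₁c
  have hb : Measurable b := measurable_sInf_fiber hG₂c
  refine ⟨fun x => (a x, b (x, a x)), ha.prodMk (hb.comp (measurable_id.prodMk ha)), fun x => ?_⟩
  have h1 : (x, a x) ∈ G₁ := by
    have hc : IsClosed {b : I | (x, b) ∈ G₁} := hG₁c.preimage (by fun_prop)
    refine hc.sInf_mem ?_
    obtain ⟨z, hz⟩ := hGne x
    exact ⟨z.1, ((x, z.1), z.2), hz, rfl⟩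
  have h2 : ((x, a x), b (x, a x)) ∈ G₂ := by
    have hc : IsClosed {b : I | ((x, a x), b) ∈ G₂} := hG₂c.preimage (by fun_prop)
    refine hc.sInf_mem ?_
    obtain ⟨⟨p, c⟩, hp, hpe⟩ := h1
    exact ⟨c, by rw [← hpe]; exact hp⟩
  exact ⟨h2.1.2, h2.2⟩

variable {μ : ℝ}

/-! ### Two-point experiments -/

/-- The probability of `z.2` under the distribution on `{z.1, z.2}` with average `μ`. -/
def upperWeight (μ : ℝ) (z : I × I) : ℝ := (μ - z.1) / (z.2 - z.1)

/-- `z.1 ≤ μ ≤ z.2`. -/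
def Straddles (μ : ℝ) (z : I × I) : Prop := (z.1 : ℝ) ≤ μ ∧ μ ≤ z.2

theorem upperWeight_nonneg {z : I × I} (hz : Straddles μ z) : 0 ≤ upperWeight μ z :=
  div_nonneg (by linarith [hz.1]) (by linarith [hz.1, hz.2])

theorem upperWeight_le_one {z : I × I} (hz : Straddles μ z) : upperWeight μ z ≤ 1 :=
  div_le_one_of_le₀ (by linarith [hz.2]) (by linarith [hz.1, hz.2])

theorem upperWeight_mul_sub {z : I × I} (hz : Straddles μ z) :
    upperWeight μ z * (z.2 - z.1) = μ - z.1 := by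
  rcases eq_or_ne ((z.2 : ℝ) - z.1) 0 with h | h
  · rw [h]; linarith [hz.1, hz.2]
  · exact div_mul_cancel₀ _ h

@[fun_prop]
theorem measurable_upperWeight : Measurable (upperWeight μ) := by
  unfold upperWeight; fun_prop

def twoPointDist (μ : ℝ) (z : I × I) : Measure I :=
  ENNReal.ofReal (1 - upperWeight μ z) • Measure.dirac z.1
    + ENNReal.ofReal (upperWeight μ z) • Measure.dirac z.2

theorem measurable_twoPointDist : Measurable (twoPointDist μ) := by
  refine Measure.measurable_of_measurable_coe _ fun s hs => ?_
  simp only [twoPointDist, Measure.coe_add, Measure.coe_smul, Pi.add_apply, Pi.smul_apply,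
    smul_eq_mul, Measure.dirac_apply' _ hs]
  have h : Measurable (s.indicator (1 : I → ENNReal)) := measurable_one.indicator hs
  exact ((by fun_prop : Measurable fun z => ENNReal.ofReal (1 - upperWeight μ z)).mul
    (h.comp measurable_fst)).add
    ((by fun_prop : Measurable fun z => ENNReal.ofReal (upperWeight μ z)).mul
    (h.comp measurable_snd))

theorem integrable_dirac_real (g : I → ℝ) (x : I) : Integrable g (Measure.dirac x) :=
  integrable_dirac (by simp)

theorem integral_twoPointDist {z : I × I} (hz : Straddles μ z) (g : I → ℝ) :
    ∫ y, g y ∂twoPointDist μ z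
      = (1 - upperWeight μ z) * g z.1 + upperWeight μ z * g z.2 := by
  rw [twoPointDist, integral_add_measure
    ((integrable_dirac_real g _).smul_measure ENNReal.ofReal_ne_top)
    ((integrable_dirac_real g _).smul_measure ENNReal.ofReal_ne_top),
    integral_smul_measure, integral_smul_measure, integral_dirac, integral_dirac,
    ENNReal.toReal_ofReal (upperWeight_nonneg hz),
    ENNReal.toReal_ofReal (sub_nonneg.2 (upperWeight_le_one hz)), smul_eq_mul, smul_eq_mul]

/-- The experiment with outcomes `z.1 ≤ μ ≤ z.2`. -/
def twoPoint (z : I × I) (hz : Straddles μ z) : Experiment μ where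
  dist := twoPointDist μ z
  isProb := ⟨by
    have h1 := sub_nonneg.2 (upperWeight_le_one hz)
    simp [twoPointDist, ← ENNReal.ofReal_add h1 (upperWeight_nonneg hz)]⟩
  mean_eq := by
    rw [integral_twoPointDist hz]
    linarith [upperWeight_mul_sub hz]

/-! ### Garblings and expected excesses -/

theorem integrable_of_continuous {ν : Measure I} [IsFiniteMeasure ν] {g : I → ℝ}
    (hg : Continuous g) : Integrable g ν :=
  hg.integrable_of_hasCompactSupport (HasCompactSupport.of_compactSpace g)

theorem Experiment.integral_affine (d : Experiment μ) (a b : ℝ) :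
    ∫ y, (a + b * (y : ℝ)) ∂d.dist = a + b * μ := by
  rw [integral_add (integrable_const _) (integrable_of_continuous (by fun_prop)),
    integral_const_mul, d.mean_eq]
  simp

/-- The expected excess of the posterior of `d` over `c`. -/
def callValue (d : Experiment μ) (c : ℝ) : ℝ := ∫ y, max ((y : ℝ) - c) 0 ∂d.dist

/-- The function min(y, c) = y - max(y-c, 0) is concave and nondecreasing, and the means agree. -/
theorem callValue_le_of_isGarbling {q d : Experiment μ} (h : IsGarbling q d) (c : ℝ) :
    callValue q c ≤ callValue d c := by
  have hu := h (fun y => min y c) ((concaveOn_id convex_univ).inf (concaveOn_const c convex_univ))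
    (monotone_id.min monotone_const)
  have key : ∀ e : Experiment μ, callValue e c = μ - ∫ y, min (y : ℝ) c ∂e.dist := by
    intro e
    have hsub := integral_sub (μ := e.dist) (f := fun y : I => (y : ℝ))
      (g := fun y : I => min (y : ℝ) c) (integrable_of_continuous (by fun_prop))
      (integrable_of_continuous (by fun_prop))
    rw [e.mean_eq] at hsub
    rw [← hsub]
    refine integral_congr_ae (Filter.Eventually.of_forall fun y => ?_)
    simp only
    rcases le_total (y : ℝ) c with hy | hy
    · rw [max_eq_right (by linarith), min_eq_left hy, sub_self]
    · rw [max_eq_left (by linarith), min_eq_right hy]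
  rw [key, key]
  linarith

/-- The pairs of outcomes of the two-point garblings of `d`. -/
def feasible (d : Experiment μ) : Set (I × I) :=
  {z | Straddles μ z ∧
    -- The weight of `z.2` times its excess over `c`, multiplied through by `z.2 - z.1`. Without the
    -- division the condition is closed and admits the degenerate pair (μ, μ).
    ∀ c : ℝ, (μ - z.1) * (z.2 - c) ≤ (z.2 - z.1) * callValue d c}

theorem isClosed_feasible (d : Experiment μ) : IsClosed (feasible d) := by
  have : feasible d = {z : I × I | (z.1 : ℝ) ≤ μ} ∩ {z : I × I | μ ≤ (z.2 : ℝ)} ∩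
      ⋂ c : ℝ, {z : I × I | (μ - z.1) * (z.2 - c) ≤ (z.2 - z.1) * callValue d c} := by
    ext z
    simp [feasible, Straddles]
  rw [this]
  refine ((isClosed_le (by fun_prop) (by fun_prop)).inter
    (isClosed_le (by fun_prop) (by fun_prop))).inter (isClosed_iInter fun c => ?_)
  exact isClosed_le (by fun_prop) (by fun_prop)

theorem exists_affine_ge {u : ℝ → ℝ} (hu : ConcaveOn ℝ Set.univ u) (x : ℝ) :
    ∃ s : ℝ, ∀ y, u y ≤ u x + s * (y - x) := by
  have hv := hu.neg
  have hx : x ∈ interior (Set.univ : Set ℝ) := by simp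
  refine ⟨-derivWithin (-u) (Set.Ioi x) x, fun y => ?_⟩
  rcases lt_trichotomy x y with h | rfl | h
  · have := hv.rightDeriv_le_slope_of_mem_interior hx trivial h
    rw [slope_def_field, le_div_iff₀ (by linarith)] at this
    simp only [Pi.neg_apply] at this
    linarith
  · simp
  · have := (hv.slope_le_leftDeriv_of_mem_interior trivial hx h).trans
      (hv.leftDeriv_le_rightDeriv_of_mem_interior hx)
    rw [slope_def_field, div_le_iff₀ (by linarith)] at this
    simp only [Pi.neg_apply] at this
    linarith

/-- A concave `u` lies below the minimum of its supporting lines at the two outcomes. That minimum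
is an affine function minus a multiple of one excess function, whose integral feasibility controls.
-/
theorem isGarbling_twoPoint {d : Experiment μ} {z : I × I} (hz : z ∈ feasible d) :
    IsGarbling (twoPoint z hz.1) d := by
  intro u hu _
  have huc : Continuous u := continuousOn_univ.1 (hu.continuousOn isOpen_univ)
  have hui : Integrable (fun y : I => u y) d.dist := integrable_of_continuous (by fun_prop)
  change _ ≤ ∫ y, u (y : ℝ) ∂twoPointDist μ z
  rw [integral_twoPointDist hz.1]
  obtain ⟨s, hs⟩ := exists_affine_ge hu z.1
  obtain ⟨t, ht⟩ := exists_affine_ge hu z.2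
  have hw := upperWeight_mul_sub hz.1
  have hw0 := upperWeight_nonneg hz.1
  have hw1 := upperWeight_le_one hz.1
  have hfe := hz.2
  have h12 : (z.1 : ℝ) ≤ z.2 := hz.1.1.trans hz.1.2
  set w := upperWeight μ z
  set l : ℝ := (z.1 : ℝ)
  set h : ℝ := (z.2 : ℝ)
  have bound : ∀ s x : ℝ, (∀ y, u y ≤ u x + s * (y - x)) →
      ∫ y, u (y : ℝ) ∂d.dist ≤ u x + s * (μ - x) := by
    intro s x hs
    have := d.integral_affine (u x - s * x) s
    calc ∫ y, u (y : ℝ) ∂d.dist ≤ ∫ y, ((u x - s * x) + s * (y : ℝ)) ∂d.dist :=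
          integral_mono hui (integrable_of_continuous (by fun_prop))
            fun y => by have := hs y; simp only; linarith
      _ = _ := by rw [this]; ring
  have hb1 := bound s l hs
  have hb2 := bound t h ht
  -- If the slopes do not decrease, averaging the two tangent bounds with the weights of the
  -- outcomes is already enough.
  rcases le_or_gt s t with hst | hst
  · rw [← hw] at hb1
    rw [show μ - h = -((1 - w) * (h - l)) by linarith] at hb2
    have h1 := mul_le_mul_of_nonneg_left hb1 (sub_nonneg.2 hw1)
    have h2 := mul_le_mul_of_nonneg_left hb2 hw0
    have h3 := mul_nonneg (mul_nonneg hw0 (sub_nonneg.2 hw1))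
      (mul_nonneg (sub_nonneg.2 hst) (sub_nonneg.2 h12))
    linarith
  · rcases h12.eq_or_lt with heq | hlt
    · have : μ = l := by linarith [hz.1.1, hz.1.2]
      have e : u h = u l := by rw [heq]
      rw [e]
      rw [show μ - l = 0 by linarith] at hb1
      linarith
    -- The threshold at which the two supporting lines cross; feasibility is needed only there.
    obtain ⟨c, hc⟩ : ∃ c, u l + s * (c - l) = u h + t * (c - h) :=
      ⟨(u h - u l + s * l - t * h) / (s - t), by
        have : s - t ≠ 0 := by linarith
        field_simp; ring⟩
    have hm : ∫ y, u (y : ℝ) ∂d.dist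
        ≤ ∫ y, ((u l - s * l) + s * (y : ℝ) - (s - t) * max ((y : ℝ) - c) 0) ∂d.dist := by
      refine integral_mono hui (integrable_of_continuous (by fun_prop)) fun y => ?_
      have h1 := hs y
      have h2 := ht y
      simp only
      rcases le_total (y : ℝ) c with hy | hy
      · rw [max_eq_right (by linarith)]; linarith
      · rw [max_eq_left (by linarith)]; linarith
    rw [integral_sub (integrable_of_continuous (by fun_prop))
      (integrable_of_continuous (by fun_prop)), d.integral_affine, integral_const_mul] at hm
    change _ ≤ _ - (s - t) * callValue d c at hm
    have hcall : w * (h - c) ≤ callValue d c := by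
      have := hfe c
      rw [← hw] at this
      have hpos : 0 < h - l := by linarith
      nlinarith
    have := mul_le_mul_of_nonneg_left hcall (sub_pos.2 hst).le
    have hμ : s * μ = s * (l + w * (h - l)) := congrArg (s * ·) (by linarith)
    have huh : u h = u l + s * (h - l) - (s - t) * (h - c) := by linarith
    rw [huh]
    linarith

/-! ### The second visit -/

/-- The payoff from a draw `y` at the second visit when `x` was drawn at the first one. -/
def drawPayoff (k μ : ℝ) (x y : I) : ℝ := max (x : ℝ) y - beliefCost k μ y

/-- The payoff from the two-point garbling with outcomes `p.2`, given the first draw `p.1`. -/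
def splitValue (k μ : ℝ) (p : I × (I × I)) : ℝ :=
  (1 - upperWeight μ p.2) * drawPayoff k μ p.1 p.2.1
    + upperWeight μ p.2 * drawPayoff k μ p.1 p.2.2

theorem continuous_drawPayoff (k μ : ℝ) : Continuous fun p : I × I => drawPayoff k μ p.1 p.2 := by
  unfold drawPayoff beliefCost; fun_prop

theorem integrable_drawPayoff (k μ : ℝ) (x : I) (ν : Measure I) [IsFiniteMeasure ν] :
    Integrable (drawPayoff k μ x) ν :=
  integrable_of_continuous ((continuous_drawPayoff k μ).comp (by fun_prop : Continuous (x, ·)))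

theorem measurable_splitValue (k μ : ℝ) : Measurable (splitValue k μ) := by
  have h := (continuous_drawPayoff k μ).measurable
  have h1 : Measurable fun p : I × (I × I) => drawPayoff k μ p.1 p.2.1 :=
    h.comp (by fun_prop : Measurable fun p : I × (I × I) => (p.1, p.2.1))
  have h2 : Measurable fun p : I × (I × I) => drawPayoff k μ p.1 p.2.2 :=
    h.comp (by fun_prop : Measurable fun p : I × (I × I) => (p.1, p.2.2))
  unfold splitValue
  fun_prop

/-- The weight itself can jump where both outcomes collapse to μ. There the value is still a convex
combination of two payoffs with the same limit, so it is squeezed. -/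
theorem continuousOn_splitValue (k μ : ℝ) :
    ContinuousOn (splitValue k μ) (Set.univ ×ˢ {z | Straddles μ z}) := by
  rintro ⟨x, z⟩ ⟨-, hz⟩
  have hz : Straddles μ z := hz
  have h1 : Continuous fun p : I × (I × I) => drawPayoff k μ p.1 p.2.1 :=
    (continuous_drawPayoff k μ).comp (by fun_prop : Continuous fun p : I × (I × I) => (p.1, p.2.1))
  have h2 : Continuous fun p : I × (I × I) => drawPayoff k μ p.1 p.2.2 :=
    (continuous_drawPayoff k μ).comp (by fun_prop : Continuous fun p : I × (I × I) => (p.1, p.2.2))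
  rcases (hz.1.trans hz.2).eq_or_lt with he | hlt
  · have he' : z.2 = z.1 := Subtype.ext he.symm
    have hval : splitValue k μ (x, z) = drawPayoff k μ x z.1 := by
      simp only [splitValue, he']; ring
    rw [ContinuousWithinAt, hval, tendsto_iff_dist_tendsto_zero]
    have hlim : Filter.Tendsto (fun p : I × (I × I) =>
        |drawPayoff k μ p.1 p.2.1 - drawPayoff k μ x z.1|
          + |drawPayoff k μ p.1 p.2.2 - drawPayoff k μ x z.1|)
        (nhdsWithin (x, z) (Set.univ ×ˢ {z | Straddles μ z})) (nhds 0) := by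
      have hc : Continuous (fun p : I × (I × I) =>
        |drawPayoff k μ p.1 p.2.1 - drawPayoff k μ x z.1|
          + |drawPayoff k μ p.1 p.2.2 - drawPayoff k μ x z.1|) := by fun_prop
      have := (hc.tendsto (x, z)).mono_left
        (nhdsWithin_le_nhds (s := Set.univ ×ˢ {z | Straddles μ z}))
      simpa [he'] using this
    refine squeeze_zero' (Filter.Eventually.of_forall fun _ => dist_nonneg) ?_ hlim
    filter_upwards [self_mem_nhdsWithin] with p hp
    have hp : Straddles μ p.2 := hp.2
    have hw0 := upperWeight_nonneg hp
    have hw1 := upperWeight_le_one hp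
    rw [Real.dist_eq, splitValue]
    set m := drawPayoff k μ x z.1
    set a := drawPayoff k μ p.1 p.2.1
    set b := drawPayoff k μ p.1 p.2.2
    set w := upperWeight μ p.2
    calc |(1 - w) * a + w * b - m| = |(1 - w) * (a - m) + w * (b - m)| := by ring_nf
      _ ≤ |(1 - w) * (a - m)| + |w * (b - m)| := abs_add_le _ _
      _ = (1 - w) * |a - m| + w * |b - m| := by
        rw [abs_mul, abs_mul, abs_of_nonneg hw0, abs_of_nonneg (sub_nonneg.2 hw1)]
      _ ≤ 1 * |a - m| + 1 * |b - m| := by gcongr; linarith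
      _ = _ := by ring
  · have hw : ContinuousAt (fun p : I × (I × I) => upperWeight μ p.2) (x, z) := by
      unfold upperWeight
      exact ContinuousAt.div (by fun_prop) (by fun_prop) (sub_pos.2 hlt).ne'
    exact (((continuousAt_const.sub hw).mul h1.continuousAt).add
      (hw.mul h2.continuousAt)).continuousWithinAt

/-- Jensen on `T`: the square lies above its tangent at the conditional mean `h`. -/
theorem mul_sq_le_setIntegral_sq (ν : Measure I) [IsProbabilityMeasure ν] (T : Set I) (m h : ℝ)
    (hh : ∫ y in T, (y : ℝ) ∂ν = ν.real T * h) :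
    ν.real T * (h - m) ^ 2 ≤ ∫ y in T, ((y : ℝ) - m) ^ 2 ∂ν := by
  calc ν.real T * (h - m) ^ 2
      = ∫ y in T, (((h - m) ^ 2 - 2 * (h - m) * h) + 2 * (h - m) * (y : ℝ)) ∂ν := by
        rw [integral_add (integrable_const _) (integrable_of_continuous (by fun_prop)),
          integral_const_mul, hh, integral_const]
        simp; ring
    _ ≤ _ := by
        refine integral_mono (integrable_of_continuous (by fun_prop))
          (integrable_of_continuous (by fun_prop)) fun y => ?_
        have := sq_nonneg ((y : ℝ) - h)
        simp only
        linarith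

/-- Two-point garblings are optimal at the second visit. -/
theorem exists_feasible_ge {k : ℝ} (hk : 0 ≤ k) (hμ : μ ∈ I) {q d : Experiment μ}
    (h : IsGarbling q d) (x : I) :
    ∃ z ∈ feasible d, ∫ y, drawPayoff k μ x y ∂q.dist ≤ splitValue k μ (x, z) := by
  -- `T` collects the draws for which the second sender is selected. The selected value is affine on
  -- `T` and on its complement, so pooling each side to its mean preserves it and lowers the convex
  -- cost.
  set T : Set I := Set.Ioi x with hT
  have hTm : MeasurableSet T := measurableSet_Ioi
  have hint : ∀ (g : I → ℝ) (s : Set I), Continuous g → Integrable g (q.dist.restrict s) :=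
    fun g s hg => integrable_of_continuous hg
  set w := q.dist.real T with hw
  have hwc : q.dist.real Tᶜ = 1 - w := probReal_compl_eq_one_sub hTm
  have hw0 : 0 ≤ w := measureReal_nonneg
  have hw1 : w ≤ 1 := measureReal_le_one
  have hmean : ∫ y in T, (y : ℝ) ∂q.dist + ∫ y in Tᶜ, (y : ℝ) ∂q.dist = μ := by
    rw [integral_add_compl hTm (integrable_of_continuous (by fun_prop)), q.mean_eq]
  have hval : ∫ y, drawPayoff k μ x y ∂q.dist
      = (∫ y in T, (y : ℝ) ∂q.dist - k * ∫ y in T, ((y : ℝ) - μ) ^ 2 ∂q.dist)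
        + ((1 - w) * x - k * ∫ y in Tᶜ, ((y : ℝ) - μ) ^ 2 ∂q.dist) := by
    rw [← integral_add_compl hTm (integrable_drawPayoff k μ x _), ← hwc]
    congr 1
    · rw [← integral_const_mul, ← integral_sub (hint _ _ (by fun_prop)) (hint _ _ (by fun_prop))]
      refine setIntegral_congr_fun hTm fun y hy => ?_
      simp only [drawPayoff, beliefCost, max_eq_right (show (x : ℝ) ≤ y from le_of_lt hy)]
    · rw [← integral_const_mul, show q.dist.real Tᶜ * (x : ℝ) = ∫ y in Tᶜ, (x : ℝ) ∂q.dist by simp,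
        ← integral_sub (hint _ _ (by fun_prop)) (hint _ _ (by fun_prop))]
      refine setIntegral_congr_fun hTm.compl fun y hy => ?_
      simp only [drawPayoff, beliefCost, max_eq_left (show (y : ℝ) ≤ x from not_lt.1 hy)]
  have hsq : ∀ s : Set I, 0 ≤ ∫ y in s, ((y : ℝ) - μ) ^ 2 ∂q.dist :=
    fun s => integral_nonneg fun y => sq_nonneg _
  -- When one side has no mass, learning nothing does at least as well.
  have hpool : ∀ b : ℝ, b ≤ max (x : ℝ) μ → ∫ y, drawPayoff k μ x y ∂q.dist ≤ b →
      ∃ z ∈ feasible d, ∫ y, drawPayoff k μ x y ∂q.dist ≤ splitValue k μ (x, z) := by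
    intro b hb hle
    refine ⟨(⟨μ, hμ⟩, ⟨μ, hμ⟩), ⟨⟨le_rfl, le_rfl⟩, by simp⟩, (hle.trans hb).trans_eq ?_⟩
    simp only [splitValue, drawPayoff, beliefCost]
    ring
  rcases hw0.eq_or_lt with h0 | h0
  · have hz : q.dist T = 0 := (measureReal_eq_zero_iff (by simp)).1 h0.symm
    refine hpool x (le_max_left _ _) ?_
    rw [hval, ← h0, setIntegral_measure_zero _ hz, setIntegral_measure_zero _ hz]
    have := mul_nonneg hk (hsq Tᶜ)
    linarith
  rcases hw1.eq_or_lt with h1 | h1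
  · have hz : q.dist Tᶜ = 0 := (measureReal_eq_zero_iff (by simp)).1 (by rw [hwc, h1]; ring)
    refine hpool μ (le_max_right _ _) ?_
    rw [setIntegral_measure_zero _ hz] at hmean
    rw [hval, h1, setIntegral_measure_zero _ hz]
    have := mul_nonneg hk (hsq T)
    linarith
  have h1' : 0 < 1 - w := by linarith
  have hbnd : ∀ (s : Set I) (a b : ℝ), MeasurableSet s → (∀ y ∈ s, a ≤ (y : ℝ) ∧ (y : ℝ) ≤ b) →
      q.dist.real s * a ≤ ∫ y in s, (y : ℝ) ∂q.dist ∧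
      ∫ y in s, (y : ℝ) ∂q.dist ≤ q.dist.real s * b := by
    intro s a b hs hab
    constructor
    · rw [show q.dist.real s * a = ∫ y in s, a ∂q.dist by simp]
      exact setIntegral_mono_on (hint _ _ (by fun_prop)) (hint _ _ (by fun_prop)) hs
        fun y hy => (hab y hy).1
    · rw [show q.dist.real s * b = ∫ y in s, b ∂q.dist by simp]
      exact setIntegral_mono_on (hint _ _ (by fun_prop)) (hint _ _ (by fun_prop)) hs
        fun y hy => (hab y hy).2
  obtain ⟨hA1, hA2⟩ := hbnd T x 1 hTm fun y hy => ⟨le_of_lt hy, y.2.2⟩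
  obtain ⟨hB1, hB2⟩ := hbnd Tᶜ 0 x hTm.compl fun y hy => ⟨y.2.1, not_lt.1 hy⟩
  rw [hwc] at hB1 hB2
  have hsT := mul_sq_le_setIntegral_sq q.dist T μ ((∫ y in T, (y : ℝ) ∂q.dist) / w)
    (by rw [← hw]; field_simp)
  have hsTc := mul_sq_le_setIntegral_sq q.dist Tᶜ μ ((∫ y in Tᶜ, (y : ℝ) ∂q.dist) / (1 - w))
    (by rw [hwc]; field_simp)
  have hcall : ∀ c : ℝ, ∫ y in T, (y : ℝ) ∂q.dist - w * c ≤ callValue d c := by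
    intro c
    refine le_trans ?_ (callValue_le_of_isGarbling h c)
    calc ∫ y in T, (y : ℝ) ∂q.dist - w * c = ∫ y in T, ((y : ℝ) - c) ∂q.dist := by
          rw [integral_sub (hint _ _ (by fun_prop)) (integrable_const _)]; simp [hw]
      _ ≤ ∫ y in T, max ((y : ℝ) - c) 0 ∂q.dist :=
          integral_mono (hint _ _ (by fun_prop)) (hint _ _ (by fun_prop))
            fun y => le_max_left _ _
      _ ≤ _ := setIntegral_le_integral (integrable_of_continuous (by fun_prop))
            (Filter.Eventually.of_forall fun y => le_max_right _ _)
  set A := ∫ y in T, (y : ℝ) ∂q.dist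
  set B := ∫ y in Tᶜ, (y : ℝ) ∂q.dist
  obtain ⟨hi, hhi⟩ : ∃ hi, hi = A / w := ⟨_, rfl⟩
  obtain ⟨lo, hlo⟩ : ∃ lo, lo = B / (1 - w) := ⟨_, rfl⟩
  rw [← hhi] at hsT
  rw [← hlo] at hsTc
  have hA : A = w * hi := by rw [hhi]; field_simp
  have hB : B = (1 - w) * lo := by rw [hlo]; field_simp
  have hx0 := x.2.1
  have hx1 := x.2.2
  have xhi : (x : ℝ) ≤ hi := by rw [hhi, le_div_iff₀ h0]; linarith
  have hi1 : hi ≤ 1 := by rw [hhi, div_le_iff₀ h0]; linarith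
  have lox : lo ≤ x := by rw [hlo, div_le_iff₀ h1']; linarith
  have lo0 : 0 ≤ lo := by rw [hlo, le_div_iff₀ h1']; linarith
  have hwlo : μ - lo = w * (hi - lo) := by linarith
  have hwhi : hi - μ = (1 - w) * (hi - lo) := by linarith
  have hlohi : 0 ≤ hi - lo := by linarith
  have loI : lo ∈ I := ⟨lo0, by linarith⟩
  have hiI : hi ∈ I := ⟨by linarith, hi1⟩
  have hst : Straddles μ ((⟨lo, loI⟩, ⟨hi, hiI⟩) : I × I) :=
    ⟨by have := mul_nonneg hw0 hlohi; simp only; linarith,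
     by have := mul_nonneg h1'.le hlohi; simp only; linarith⟩
  refine ⟨_, ⟨hst, fun c => ?_⟩, ?_⟩
  · simp only
    rw [hwlo]
    have := mul_le_mul_of_nonneg_left (hcall c) hlohi
    rw [hA] at this
    linarith
  · rw [hval, hA]
    have hS : splitValue k μ (x, ((⟨lo, loI⟩, ⟨hi, hiI⟩) : I × I))
        = (1 - w) * (x - k * (lo - μ) ^ 2) + w * (hi - k * (hi - μ) ^ 2) := by
      simp only [splitValue, drawPayoff, beliefCost, max_eq_left lox, max_eq_right xhi]
      rcases hlohi.eq_or_lt with he | hlt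
      · have e1 : hi = x := by linarith
        have e2 : lo = x := by linarith
        generalize upperWeight μ _ = v
        rw [e1, e2]; ring
      · have : upperWeight μ ((⟨lo, loI⟩, ⟨hi, hiI⟩) : I × I) = w := by
          simp only [upperWeight]; rw [hwlo]; field_simp
        rw [this]
    rw [hS]
    rw [hwc] at hsTc
    have g1 := mul_le_mul_of_nonneg_left hsT hk
    have g2 := mul_le_mul_of_nonneg_left hsTc hk
    linarith

theorem integral_twoPoint_drawPayoff (k : ℝ) (x : I) {z : I × I} (hz : Straddles μ z) :
    ∫ y, drawPayoff k μ x y ∂(twoPoint z hz).dist = splitValue k μ (x, z) :=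
  integral_twoPointDist hz _

/-- An optimal garbling at the second visit, measurable in the first draw. -/
theorem exists_measurable_optimal_split {k : ℝ} (hk : 0 ≤ k) (hμ : μ ∈ I) (d : Experiment μ) :
    ∃ sel : I → I × I, Measurable sel ∧ ∀ x, sel x ∈ feasible d ∧
      ∀ q : Experiment μ, IsGarbling q d →
        ∫ y, drawPayoff k μ x y ∂q.dist ≤ splitValue k μ (x, sel x) := by
  obtain ⟨sel, hm, hs⟩ := exists_measurable_argmax (isClosed_feasible d)
    ⟨(⟨μ, hμ⟩, ⟨μ, hμ⟩), ⟨le_rfl, le_rfl⟩, by simp⟩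
    ((continuousOn_splitValue k μ).mono (Set.prod_mono le_rfl fun z hz => hz.1))
  refine ⟨sel, hm, fun x => ⟨(hs x).1, fun q hq => ?_⟩⟩
  obtain ⟨z, hz, hle⟩ := exists_feasible_ge hk hμ hq x
  exact hle.trans ((hs x).2 z hz)

/-! ### Bounds on the receiver's payoff -/

/-- The right side is the common tangent of the two parabolas: its gap is k(y-x+δ)² to the one where
`x` is kept and k(y-x-δ)² to the other. -/
theorem drawPayoff_le_affine {k δ : ℝ} (hkδ : 4 * k * δ = 1) (hk : 0 ≤ k) (x y : I) :
    drawPayoff k μ x y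
      ≤ (μ + k * (x - μ + δ) ^ 2 + 2 * k * (x - μ - δ) * μ) + (-2 * k * (x - μ - δ)) * y := by
  unfold drawPayoff beliefCost
  have h1 := mul_nonneg hk (sq_nonneg ((y : ℝ) - x + δ))
  have h2 := mul_nonneg hk (sq_nonneg ((y : ℝ) - x - δ))
  have ex : (x : ℝ) = 4 * k * δ * x := by rw [hkδ, one_mul]
  have ey : (y : ℝ) = 4 * k * δ * y := by rw [hkδ, one_mul]
  have eμ : μ = 4 * k * δ * μ := by rw [hkδ, one_mul]
  rcases max_cases (x : ℝ) y with ⟨h, _⟩ | ⟨h, _⟩ <;> rw [h] <;> linarith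

theorem integral_drawPayoff_le {k δ : ℝ} (hkδ : 4 * k * δ = 1) (hk : 0 ≤ k) (q : Experiment μ)
    (x : I) : ∫ y, drawPayoff k μ x y ∂q.dist ≤ μ + k * (x - μ + δ) ^ 2 := by
  calc _ ≤ _ := integral_mono (integrable_drawPayoff k μ x _)
        (integrable_of_continuous (by fun_prop)) (drawPayoff_le_affine hkδ hk x)
    _ = _ := by rw [q.integral_affine]; ring

/-- The gaps are the squares k(x-μ+δ)² and k(x-μ-δ)², so stopping attains the bound at x = μ-δ and x
= μ+δ. -/
theorem max_le_of_pool {k δ : ℝ} (hkδ : 4 * k * δ = 1) (hk : 0 ≤ k) (x : I) :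
    max (x : ℝ) μ ≤ μ + k * (x - μ + δ) ^ 2 := by
  have h1 := mul_nonneg hk (sq_nonneg ((x : ℝ) - μ + δ))
  have h2 := mul_nonneg hk (sq_nonneg ((x : ℝ) - μ - δ))
  have ex : (x : ℝ) = 4 * k * δ * x := by rw [hkδ, one_mul]
  have eμ : μ = 4 * k * δ * μ := by rw [hkδ, one_mul]
  exact max_le (by linarith) (by linarith)

theorem Continuation.finalOne_le (c : Continuation μ) (x : I) : c.finalOne x ≤ max (x : ℝ) μ := by
  unfold Continuation.finalOne
  split_ifs
  exacts [le_max_left _ _, le_max_right _ _]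

theorem Continuation.finalBoth_le (c : Continuation μ) (d : Experiment μ) (x y : I) :
    c.finalBoth d x y ≤ max (x : ℝ) y := by
  unfold Continuation.finalBoth
  split_ifs
  exacts [le_max_left _ _, le_max_right _ _]

theorem Continuation.valueBoth_le (k : ℝ) (c : Continuation μ) (d : Experiment μ) (x : I) :
    c.valueBoth k d x ≤ ∫ y, drawPayoff k μ x y ∂(c.garble d x).dist := by
  refine integral_mono (Integrable.sub ?_ (integrable_of_continuous ?_))
    (integrable_drawPayoff k μ x _) fun y => sub_le_sub_right (c.finalBoth_le d x y) _
  · refine Integrable.of_bound (C := 1) ?_ (Filter.Eventually.of_forall fun y => ?_)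
    · have hm : MeasurableSet {y | c.keepBoth d x y = true} :=
        ((c.measurable_keepBoth d).comp (by fun_prop : Measurable fun y : I => (x, y)))
          (measurableSet_singleton true)
      exact (Measurable.ite hm measurable_const (by fun_prop)).aestronglyMeasurable
    · unfold Continuation.finalBoth
      rw [Real.norm_eq_abs]
      split_ifs
      · rw [abs_of_nonneg x.2.1]; exact x.2.2
      · rw [abs_of_nonneg y.2.1]; exact y.2.2
  · unfold beliefCost; fun_prop

theorem Continuation.value_le {k δ : ℝ} (hkδ : 4 * k * δ = 1) (hk : 0 ≤ k) (c : Continuation μ)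
    (d : Experiment μ) (x : I) : c.value k d x ≤ μ + k * (x - μ + δ) ^ 2 := by
  unfold Continuation.value
  split_ifs
  · exact (c.valueBoth_le k d x).trans (integral_drawPayoff_le hkδ hk _ x)
  · exact (c.finalOne_le x).trans (max_le_of_pool hkδ hk x)

/-- The quadratic terms of the continuation bound and of the first cost cancel. The affine remainder
has the same mean under every garbling. -/
theorem Strategy.valueAt_le {k δ : ℝ} (hkδ : 4 * k * δ = 1) (hk : 0 ≤ k) (hδ : 0 ≤ δ) (hμ : 0 ≤ μ)
    (t : Strategy μ) (i : Sender) (d e : Experiment μ) : t.valueAt k i d e ≤ μ + δ / 4 := by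
  unfold Strategy.valueAt
  by_cases hint : Integrable (fun x => (t.cont i).value k e x - beliefCost k μ x)
      (t.garble i d).dist
  · calc _ ≤ ∫ x, ((μ + δ / 4 - μ / 2) + 1 / 2 * (x : ℝ)) ∂(t.garble i d).dist := by
          refine integral_mono hint (integrable_of_continuous (by fun_prop)) fun x => ?_
          have := (t.cont i).value_le hkδ hk e x
          have ex : (x : ℝ) = 4 * k * δ * x := by rw [hkδ, one_mul]
          have eμ : μ = 4 * k * δ * μ := by rw [hkδ, one_mul]
          have eδ : δ = 4 * k * δ * δ := by rw [hkδ, one_mul]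
          simp only [beliefCost]
          linarith
      _ = _ := by rw [Experiment.integral_affine]; ring
  -- A non-integrable payoff has integral 0 by convention, which is below the nonnegative bound.
  · rw [integral_undef hint]; positivity

/-! ### The equilibrium strategy -/

/-- Behaviour after the first draw: garble into the outcomes `sel d x`, select the best sender, and
make the second visit if and only if it is worthwhile when the other sender offers `ν`. -/
def optimalContinuation (k : ℝ) (ν : Experiment μ) (sel : Experiment μ → I → I × I)
    (hm : ∀ d, Measurable (sel d)) (hs : ∀ d x, sel d x ∈ feasible d) : Continuation μ where
  goOn x := decide (max (x : ℝ) μ < splitValue k μ (x, sel ν x))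
  keep x := decide (μ ≤ x)
  garble d x := twoPoint (sel d x) (hs d x).1
  keepBoth _ x y := decide (y ≤ x)
  garble_isGarbling d x := isGarbling_twoPoint (hs d x)
  measurable_goOn := by
    refine measurable_to_bool ?_
    have : Measurable fun x : I => splitValue k μ (x, sel ν x) :=
      (measurable_splitValue k μ).comp (measurable_id.prodMk (hm ν))
    simpa [Set.preimage] using measurableSet_lt
      (by fun_prop : Measurable fun x : I => max (x : ℝ) μ) this
  measurable_keep := by
    refine measurable_to_bool ?_
    simpa [Set.preimage] using measurableSet_le (measurable_const (a := μ)) measurable_subtype_coe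
  measurable_garble d := measurable_twoPointDist.comp (hm d)
  measurable_keepBoth d := by
    refine measurable_to_bool ?_
    simpa [Set.preimage] using measurableSet_le measurable_snd measurable_fst

section

variable {k : ℝ} {ν : Experiment μ} {sel : Experiment μ → I → I × I}
  (hm : ∀ d, Measurable (sel d)) (hs : ∀ d x, sel d x ∈ feasible d)

theorem optimalContinuation_finalBoth (d : Experiment μ) (x y : I) :
    (optimalContinuation k ν sel hm hs).finalBoth d x y = max (x : ℝ) y := by
  simp only [Continuation.finalBoth, optimalContinuation, decide_eq_true_eq]
  split_ifs with h
  · exact (max_eq_left (Subtype.coe_le_coe.2 h)).symm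
  · exact (max_eq_right (Subtype.coe_le_coe.2 (le_of_lt (not_le.1 h)))).symm

theorem optimalContinuation_finalOne (x : I) :
    (optimalContinuation k ν sel hm hs).finalOne x = max (x : ℝ) μ := by
  simp only [Continuation.finalOne, optimalContinuation, decide_eq_true_eq]
  split_ifs with h
  · exact (max_eq_left h).symm
  · exact (max_eq_right (le_of_lt (not_le.1 h))).symm

theorem optimalContinuation_valueBoth (d : Experiment μ) (x : I) :
    (optimalContinuation k ν sel hm hs).valueBoth k d x = splitValue k μ (x, sel d x) := by
  simp only [Continuation.valueBoth, optimalContinuation_finalBoth]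
  exact integral_twoPoint_drawPayoff k x (hs d x).1

theorem optimalContinuation_value (x : I) :
    (optimalContinuation k ν sel hm hs).value k ν x
      = max (splitValue k μ (x, sel ν x)) (max (x : ℝ) μ) := by
  rw [Continuation.value, optimalContinuation_valueBoth, optimalContinuation_finalOne]
  simp only [optimalContinuation, decide_eq_true_eq]
  split_ifs with h
  · exact (max_eq_left h.le).symm
  · exact (max_eq_right (not_lt.1 h)).symm

end

open Classical in
/-- Visit a random sender first. If he offers `ν`, garble into the outcomes `z₀`; otherwise learn
nothing from him. -/
def equilibriumStrategy (ν : Experiment μ) (z₀ m : I × I) (h₀ : z₀ ∈ feasible ν)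
    (hmf : ∀ d : Experiment μ, m ∈ feasible d) (c : Continuation μ) : Strategy μ where
  first := .visit ⟨1 / 2, by norm_num, by norm_num⟩
  garble _ d := if d = ν then twoPoint z₀ h₀.1 else twoPoint m (hmf d).1
  garble_isGarbling _ d := by
    split_ifs with h
    · subst h; exact isGarbling_twoPoint h₀
    · exact isGarbling_twoPoint (hmf d)
  cont _ := c

theorem exists_equilibrium {k δ : ℝ} (hkδ : 4 * k * δ = 1) (hk : 0 < k) (hδ : 0 < δ)
    (ν : Experiment μ) (lo hi : I) (hlo : (lo : ℝ) = μ - δ) (hhi : (hi : ℝ) = μ + δ)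
    (hfe : (lo, hi) ∈ feasible ν) :
    ∃ s : Strategy μ, IsEquilibrium k (fun _ => ν) s := by
  have hμ0 : 0 ≤ μ := by linarith [lo.2.1]
  have hμ : μ ∈ I := ⟨hμ0, by linarith [hi.2.2]⟩
  obtain ⟨m, hmμ⟩ : ∃ m : I, (m : ℝ) = μ := ⟨⟨μ, hμ⟩, rfl⟩
  have hkδ2 : k * δ ^ 2 = δ / 4 := by linear_combination δ / 4 * hkδ
  have hw : upperWeight μ (lo, hi) = 1 / 2 := by
    simp only [upperWeight, hlo, hhi]
    rw [div_eq_div_iff (by linarith) two_ne_zero]; ring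
  have hcost : beliefCost k μ lo = δ / 4 ∧ beliefCost k μ hi = δ / 4 := by
    simp only [beliefCost, hlo, hhi]
    constructor <;> linear_combination hkδ2
  have hsplit : splitValue k μ (m, (lo, hi)) = μ + δ / 4 := by
    simp only [splitValue, drawPayoff, hw, hcost, hmμ, hlo, hhi]
    rw [max_eq_left (by linarith), max_eq_right (by linarith)]
    ring
  have hmf : ∀ d : Experiment μ, (m, m) ∈ feasible d := fun d =>
    ⟨⟨hmμ.le, hmμ.ge⟩, by simp [hmμ]⟩
  have hsel : ∀ d : Experiment μ, ∃ sel : I → I × I, Measurable sel ∧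
      (∀ x, sel x ∈ feasible d ∧ ∀ q : Experiment μ, IsGarbling q d →
        ∫ y, drawPayoff k μ x y ∂q.dist ≤ splitValue k μ (x, sel x)) ∧
      (d = ν → sel m = (lo, hi)) := by
    intro d
    obtain ⟨sel, h1, h2⟩ := exists_measurable_optimal_split hk.le hμ d
    by_cases hd : d = ν
    · subst hd
      -- Against ν the selection is overridden at the single draw μ, where the split into μ±δ
      -- attains the upper bound. This fixes the winning probability after a deviation.
      refine ⟨fun x => if x = m then (lo, hi) else sel x,
        Measurable.ite (measurableSet_singleton m) measurable_const h1, fun x => ?_, by simp⟩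
      by_cases hx : x = m
      · subst hx
        refine ⟨by simpa using hfe, fun q _ => ?_⟩
        have := integral_drawPayoff_le hkδ hk.le q x
        rw [hmμ, sub_self, zero_add, hkδ2] at this
        simpa [hsplit] using this
      · simpa [hx] using h2 x
    · exact ⟨sel, h1, h2, fun h => absurd h hd⟩
  choose sel hm hs hν using hsel
  set c := optimalContinuation k ν sel hm (fun d x => (hs d x).1) with hc
  set s := equilibriumStrategy ν (lo, hi) (m, m) hfe hmf c with hs_def
  -- At μ±δ stopping already attains the bound, and a second visit is made only for a strict gain.
  have hgo : ∀ x : I, (x = lo ∨ x = hi) → c.goOn x = false := by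
    intro x hx
    simp only [hc, optimalContinuation, decide_eq_false_iff_not, not_lt]
    rw [← integral_twoPoint_drawPayoff k x (hs ν x).1.1]
    refine (integral_drawPayoff_le hkδ hk.le _ x).trans ?_
    rcases hx with rfl | rfl
    · refine le_max_of_le_right ?_
      rw [hlo]; ring_nf; exact le_rfl
    · refine le_max_of_le_left ?_
      rw [hhi]; linear_combination 4 * hkδ2
  have hcv : ∀ x, c.value k ν x = max (splitValue k μ (x, sel ν x)) (max (x : ℝ) μ) :=
    optimalContinuation_value hm fun d x => (hs d x).1
  have hcstop : ∀ x : I, (x = lo ∨ x = hi) → c.value k ν x = max (x : ℝ) μ := by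
    intro x hx
    rw [Continuation.value, hgo x hx, hc, optimalContinuation_finalOne]
    simp
  have hgarble : ∀ i, s.garble i ν = twoPoint (lo, hi) hfe.1 := fun i => if_pos rfl
  have hgarble' : ∀ i d, d ≠ ν → s.garble i d = twoPoint (m, m) (hmf d).1 :=
    fun i d hd => if_neg hd
  have hcont : ∀ i, s.cont i = c := fun _ => rfl
  have hval : ∀ i d, μ + δ / 4 ≤ s.valueAt k i d ν := by
    intro i d
    rw [Strategy.valueAt, hcont]
    by_cases hd : d = ν
    · rw [hd, hgarble]
      change _ ≤ ∫ x, _ ∂twoPointDist μ (lo, hi)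
      rw [integral_twoPointDist hfe.1, hw]
      simp only [hcstop lo (.inl rfl), hcstop hi (.inr rfl), hcost, hlo, hhi]
      rw [max_eq_right (by linarith), max_eq_left (by linarith)]
      linarith
    · rw [hgarble' i d hd]
      change _ ≤ ∫ x, _ ∂twoPointDist μ (m, m)
      rw [integral_twoPointDist (hmf d).1, hcv, hν ν rfl, hsplit]
      have : beliefCost k μ m = 0 := by simp [beliefCost, hmμ]
      simp only [this]
      have := le_max_left (μ + δ / 4) (max (m : ℝ) μ)
      linarith
  -- If d = ν, the first sender is kept exactly at μ+δ and `e` is never seen. Otherwise e = ν is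
  -- split into μ±δ against the uninformative draw μ, and the first sender is kept exactly when μ-δ
  -- comes up.
  have hwin : ∀ i d e, d = ν ∨ e = ν → s.winFirst i d e = 1 / 2 := by
    intro i d e hde
    rw [Strategy.winFirst, hcont]
    by_cases hd : d = ν
    · rw [hd, hgarble]
      change ∫ x, _ ∂twoPointDist μ (lo, hi) = _
      rw [integral_twoPointDist hfe.1, hw]
      have h1 : ¬ μ ≤ lo := by rw [hlo]; linarith
      have h2 : μ ≤ hi := by rw [hhi]; linarith
      simp only [Continuation.keepProb, hgo lo (.inl rfl), hgo hi (.inr rfl)]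
      simp [hc, optimalContinuation, h1, h2]
    · obtain rfl : e = ν := hde.resolve_left hd
      rw [hgarble' i d hd]
      change ∫ x, _ ∂twoPointDist μ (m, m) = _
      rw [integral_twoPointDist (hmf d).1]
      have h1 : c.goOn m = true := by
        simp only [hc, optimalContinuation, decide_eq_true_eq, hν e rfl, hsplit, hmμ, max_self]
        linarith
      have h2 : (c.garble e m).dist.real {y | c.keepBoth e m y = true} = 1 / 2 := by
        have hset : {y : I | c.keepBoth e m y = true} = Set.Iic m := by
          ext y; simp [hc, optimalContinuation]
        have hg : (c.garble e m).dist = twoPointDist μ (lo, hi) := by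
          change twoPointDist μ (sel e m) = _
          rw [hν e rfl]
        have h3 : lo ≤ m := by rw [← Subtype.coe_le_coe, hlo, hmμ]; linarith
        have h4 : ¬ hi ≤ m := by rw [← Subtype.coe_le_coe, hhi, hmμ]; linarith
        rw [hset, hg, ← integral_indicator_one measurableSet_Iic, integral_twoPointDist hfe.1, hw]
        simp [h3, h4]
        norm_num
      simp only [Continuation.keepProb, h1, h2, if_true]
      ring
  have hle : ∀ (t : Strategy μ) i d, t.valueAt k i d ν ≤ μ + δ / 4 :=
    fun t i d => t.valueAt_le hkδ hk.le hδ.le hμ0 i d ν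
  refine ⟨s, ⟨?_, fun i d t => (hle t i d).trans (hval i d), ?_, ?_, ?_, ?_⟩, ?_⟩
  · intro t
    have h1 : μ + δ / 4 ≤ s.value k fun _ => ν := by
      change _ ≤ (1 / 2 : ℝ) * s.valueAt k false ν ν + (1 - 1 / 2) * s.valueAt k true ν ν
      linarith [hval false ν, hval true ν]
    refine le_trans ?_ h1
    unfold Strategy.value
    rcases t.first with a | a
    · simp only; linarith
    · have g1 := mul_le_mul_of_nonneg_left (hle t false ν) a.2.1
      have g2 := mul_le_mul_of_nonneg_left (hle t true ν) (sub_nonneg.2 a.2.2)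
      simp only
      linarith
  · intro i x b
    rw [hcont, hcv]
    unfold Continuation.value
    split_ifs
    · exact le_max_of_le_left
        ((b.valueBoth_le k ν x).trans ((hs ν x).2 _ (b.garble_isGarbling ν x)))
    · exact le_max_of_le_right (b.finalOne_le x)
  · intro i x d b
    rw [hcont, hc, optimalContinuation_valueBoth]
    exact (b.valueBoth_le k d x).trans ((hs d x).2 _ (b.garble_isGarbling d x))
  · intro i x b
    rw [hcont, hc, optimalContinuation_finalOne]
    exact b.finalOne_le x
  · intro i x y d b
    rw [hcont, hc, optimalContinuation_finalBoth]
    exact b.finalBoth_le d x y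
  · intro i d
    have hpay : ∀ e : Experiment μ,
        s.senderPayoff (Function.update (fun _ => ν) i e) i
          = probOf ⟨1 / 2, by norm_num, by norm_num⟩ i * s.winFirst i e ν
            + probOf ⟨1 / 2, by norm_num, by norm_num⟩ (!i) * (1 - s.winFirst (!i) ν e) := by
      intro e
      simp [Strategy.senderPayoff, hs_def, equilibriumStrategy]
    have h1 := hpay d
    have h2 := hpay ν
    rw [Function.update_eq_self] at h2
    rw [h1, h2, hwin i d ν (.inr rfl), hwin _ ν d (.inl rfl), hwin i ν ν (.inl rfl),
      hwin _ ν ν (.inl rfl)]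

/-! ### Uniform distributions with an atom -/

/-- Density `a` on `[0, b]` and an atom of size `t` at `1`. -/
def blockWithAtom (a b t : ℝ) : Measure I :=
  ENNReal.ofReal a • volume.restrict {x : I | (x : ℝ) ≤ b} + ENNReal.ofReal t • Measure.dirac 1

theorem setIntegral_le_coe {b : ℝ} (hb0 : 0 ≤ b) (hb1 : b ≤ 1) (g : ℝ → ℝ) :
    ∫ x in {x : I | (x : ℝ) ≤ b}, g x = ∫ x in (0)..b, g x := by
  have h := unitInterval.measurePreserving_coe.setIntegral_preimage_emb
    (MeasurableEmbedding.subtype_coe measurableSet_Icc) g (Set.Iic b)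
  have hI : Set.Iic b ∩ I = Set.Icc 0 b := by
    ext x
    simp only [Set.mem_inter_iff, Set.mem_Iic, Set.mem_Icc]
    exact ⟨fun h => ⟨h.2.1, h.1⟩, fun h => ⟨h.2, h.1, h.2.trans hb1⟩⟩
  rw [Measure.restrict_restrict measurableSet_Iic, hI] at h
  rw [intervalIntegral.integral_of_le hb0, ← integral_Icc_eq_integral_Ioc, ← h]
  rfl

theorem volume_le_coe {b : ℝ} (hb0 : 0 ≤ b) (hb1 : b ≤ 1) :
    volume {x : I | (x : ℝ) ≤ b} = ENNReal.ofReal b :=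
  unitInterval.volume_Iic ⟨b, hb0, hb1⟩

theorem integral_blockWithAtom {a b t : ℝ} (ha : 0 ≤ a) (hb0 : 0 ≤ b) (hb1 : b ≤ 1) (ht : 0 ≤ t)
    {g : ℝ → ℝ} (hg : Continuous g) :
    ∫ x, g (x : ℝ) ∂blockWithAtom a b t = a * (∫ x in (0)..b, g x) + t * g 1 := by
  rw [blockWithAtom, integral_add_measure
    ((integrable_of_continuous (by fun_prop)).smul_measure ENNReal.ofReal_ne_top)
    ((integrable_of_continuous (by fun_prop)).smul_measure ENNReal.ofReal_ne_top),
    integral_smul_measure, integral_smul_measure, integral_dirac, setIntegral_le_coe hb0 hb1,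
    ENNReal.toReal_ofReal ha, ENNReal.toReal_ofReal ht]
  simp

/-- The experiment whose distribution is `blockWithAtom a b t`. -/
def blockExperiment {a b t : ℝ} (ha : 0 ≤ a) (hb0 : 0 ≤ b) (hb1 : b ≤ 1) (ht : 0 ≤ t)
    (hmass : a * b + t = 1) (hmean : a * (b ^ 2 / 2) + t = μ) : Experiment μ where
  dist := blockWithAtom a b t
  isProb := ⟨by
    simp [blockWithAtom, volume_le_coe hb0 hb1, ← ENNReal.ofReal_mul ha,
      ← ENNReal.ofReal_add (mul_nonneg ha hb0) ht, hmass]⟩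
  mean_eq := by
    refine (integral_blockWithAtom ha hb0 hb1 ht continuous_id).trans ?_
    simpa [integral_id] using hmean

/-- If μ ≤ b, the median is μ and the lower half has mean μ/2, so the upper half has mean 3μ/2 and δ
≤ μ/2 is needed. If t ≥ 1/2, the atom alone supplies an upper half of mean 1, and δ ≤ 1-μ is enough.
These bounds on δ are `hk1` and `hk2`. -/
theorem bothOfferInEquilibrium_blockWithAtom {k b t : ℝ} (hμ : 0 < μ) (hk : 0 < k)
    (hk1 : 1 / (2 * μ) ≤ k) (hk2 : 1 ≤ 4 * k * (1 - μ)) (hb0 : 0 ≤ b) (hb1 : b ≤ 1) (ht : 0 ≤ t)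
    (hmass : 1 / (2 * μ) * b + t = 1) (hmean : 1 / (2 * μ) * (b ^ 2 / 2) + t = μ)
    (hbt : μ ≤ b ∨ 1 / 2 ≤ t) :
    BothOfferInEquilibrium μ k (blockWithAtom (1 / (2 * μ)) b t) := by
  have ha : 0 ≤ 1 / (2 * μ) := by positivity
  set ν := blockExperiment ha hb0 hb1 ht hmass hmean with hν
  obtain ⟨δ, hδ⟩ : ∃ δ, δ = 1 / (4 * k) := ⟨_, rfl⟩
  have hδ0 : 0 < δ := by rw [hδ]; positivity
  have hkδ : 4 * k * δ = 1 := by rw [hδ]; field_simp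
  have hδμ : 2 * δ ≤ μ := by
    rw [div_le_iff₀ (by positivity)] at hk1
    rw [hδ, mul_one_div, div_le_iff₀ (by positivity)]
    linarith
  have hδμ' : δ ≤ 1 - μ := by
    rw [hδ, div_le_iff₀ (by positivity)]
    linarith
  -- Feasibility of the even split into μ±δ, with the common factor 2δ removed.
  have hcall : ∀ c : ℝ, (μ + δ - c) / 2 ≤ callValue ν c := by
    intro c
    have hv : callValue ν c
        = 1 / (2 * μ) * (∫ x in (0)..b, max (x - c) 0) + t * max (1 - c) 0 :=
      integral_blockWithAtom ha hb0 hb1 ht (g := fun x => max (x - c) 0) (by fun_prop)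
    have hii : ∀ x y : ℝ, IntervalIntegrable (fun x => max (x - c) 0) volume x y :=
      fun x y => Continuous.intervalIntegrable (by fun_prop) _ _
    have hnn : ∀ y : ℝ, 0 ≤ y → 0 ≤ ∫ x in (0)..y, max (x - c) 0 := fun y hy =>
      intervalIntegral.integral_nonneg hy fun x _ => le_max_right _ _
    rw [hv]
    rcases hbt with hb | ht'
    · have h1 : (b ^ 2 - μ ^ 2) / 2 - c * (b - μ) ≤ ∫ x in (0)..b, max (x - c) 0 := by
        rw [← intervalIntegral.integral_add_adjacent_intervals (hii 0 μ) (hii μ b)]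
        have h2 : ∫ x in μ..b, (x - c) ≤ ∫ x in μ..b, max (x - c) 0 :=
          intervalIntegral.integral_mono_on hb (Continuous.intervalIntegrable (by fun_prop) _ _)
            (hii _ _) fun x _ => le_max_left _ _
        rw [intervalIntegral.integral_sub (Continuous.intervalIntegrable (by fun_prop) _ _)
          (Continuous.intervalIntegrable (by fun_prop) _ _), integral_id,
          intervalIntegral.integral_const, smul_eq_mul] at h2
        linarith [hnn μ hμ.le]
      have h3 := mul_le_mul_of_nonneg_left h1 ha
      have h4 := mul_le_mul_of_nonneg_left (le_max_left (1 - c) 0) ht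
      have e1 : 1 / (2 * μ) * μ = 1 / 2 := by field_simp
      have e2 : 1 / (2 * μ) * μ ^ 2 = μ / 2 := by field_simp
      have e3 : 1 / (2 * μ) * b * c + t * c = c := by rw [← add_mul, hmass, one_mul]
      have e4 : 1 / (2 * μ) * μ * c = c / 2 := by rw [e1]; ring
      linarith
    · have h1 := mul_nonneg ha (hnn b hb0)
      rcases le_total c 1 with hc | hc
      · rw [max_eq_left (by linarith)]
        have := mul_le_mul_of_nonneg_right ht' (sub_nonneg.2 hc)
        linarith
      · rw [max_eq_right (by linarith)]
        linarith
  have hlo : μ - δ ∈ I := ⟨by linarith, by linarith⟩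
  have hhi : μ + δ ∈ I := ⟨by linarith, by linarith⟩
  obtain ⟨s, hs⟩ := exists_equilibrium hkδ hk hδ0 ν ⟨μ - δ, hlo⟩ ⟨μ + δ, hhi⟩ rfl rfl
    ⟨⟨by simp only; linarith, by simp only; linarith⟩, fun c => by
      have := mul_le_mul_of_nonneg_left (hcall c) (by linarith : 0 ≤ 2 * δ)
      simp only
      linarith⟩
  exact ⟨_, s, hs, fun _ => rfl⟩

theorem uniformTo_eq_blockWithAtom {b : ℝ} (hb0 : 0 < b) (hb1 : b ≤ 1) :
    uniformTo b = blockWithAtom (1 / b) b 0 := by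
  rw [uniformTo, ProbabilityTheory.cond, volume_le_coe hb0.le hb1, blockWithAtom, one_div,
    ENNReal.ofReal_inv_of_pos hb0]
  simp

theorem bothOfferInEquilibrium_uniformWithAtom {k : ℝ} (hk : 0 < k) (hμ : 1 / 2 < μ) (hμ1 : μ < 1)
    (hk1 : 1 / (2 * μ) ≤ k) (hk2 : 1 ≤ 4 * k * (1 - μ)) :
    BothOfferInEquilibrium μ k (uniformWithAtom μ) := by
  have hμ0 : 0 < μ := by linarith
  refine bothOfferInEquilibrium_blockWithAtom hμ0 hk hk1 hk2 (by linarith) (by linarith) ?_ ?_ ?_ ?_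
  · rw [sub_nonneg, div_le_iff₀ hμ0]; linarith
  · field_simp; ring
  · field_simp; ring
  · rcases le_total μ (2 / 3) with h | h
    · left; linarith
    · right
      have : 1 / μ ≤ 3 / 2 := by rw [div_le_iff₀ hμ0]; linarith
      linarith

end AttentionGame
end

/-! ### The parameter regimes -/

theorem mainTheorem10 (μ k : ℝ) (hμ0 : 0 < μ) (hμ1 : μ < 1) (hk : 0 < k) :
    (μ ≤ 1 / 2 → 1 / (2 * μ) ≤ k →
      AttentionGame.BothOfferInEquilibrium μ k (AttentionGame.uniformTo (2 * μ))) ∧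
    (1 / 2 < μ → μ ≤ 2 / 3 → 1 / (2 * μ) ≤ k →
      AttentionGame.BothOfferInEquilibrium μ k (AttentionGame.uniformWithAtom μ)) ∧
    (1 / 2 < μ → 2 / 3 ≤ μ → 1 / (4 * (1 - μ)) ≤ k →
      AttentionGame.BothOfferInEquilibrium μ k (AttentionGame.uniformWithAtom μ)) := by
  have hμ1' : 0 < 1 - μ := by linarith
  -- The two lower bounds on k cross where 2μ = 4(1-μ), that is at μ = 2/3. On each side the assumed
  -- bound implies the other.
  have key : μ ≤ 2 / 3 → 1 / (2 * μ) ≤ k → 1 ≤ 4 * k * (1 - μ) := by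
    intro h hk1
    rw [div_le_iff₀ (by positivity)] at hk1
    have := mul_nonneg hk.le (sub_nonneg.2 h)
    linarith
  refine ⟨fun h hk1 => ?_, fun h1 h2 hk1 => ?_, fun h1 h2 hk2 => ?_⟩
  · rw [AttentionGame.uniformTo_eq_blockWithAtom (by linarith) (by linarith)]
    refine AttentionGame.bothOfferInEquilibrium_blockWithAtom hμ0 hk hk1
      (key (by linarith) hk1) (by linarith) (by linarith) le_rfl ?_ ?_ (.inl (by linarith))
    · field_simp; ring
    · field_simp; ring
  · exact AttentionGame.bothOfferInEquilibrium_uniformWithAtom hk h1 hμ1 hk1 (key h2 hk1)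
  · rw [div_le_iff₀ (by positivity)] at hk2
    refine AttentionGame.bothOfferInEquilibrium_uniformWithAtom hk h1 hμ1 ?_ (by linarith)
    rw [div_le_iff₀ (by positivity)]
    have := mul_nonneg hk.le (sub_nonneg.2 h2)
    linarith
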